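/- Let $n \ge 3$ and let $\{s_j\}_{j\ge 0}$ be a binary m-sequence of order $n$, i.e. a nonzero sequence over $\mathbb{F}_2$ satisfying $s_{j+n}=c_{n-1}s_{j+n-1}+\cdots+c_1s_{j+1}+c_0s_j$ for all $j\ge 0$, where $x^n+c_{n-1}x^{n-1}+\cdots+c_1x+c_0\in\mathbb{F}_2[x]$ is a primitive polynomial (the minimal polynomial over $\mathbb{F}_2$ of a generator of $\mathbb{F}_{2^n}^*$). For $1\le t\le 2^n-1$ let $G_t=(s_{i+j})_{0\le i\le n-1,\ 0\le j\le t-1}\in\mathbb{F}_2^{n\times t}$ and let $r_n(t)=\operatorname{rank}(G_tG_t^{\top})$, the rank being taken over $\mathbb{F}_2$; regard the argument $t$ of $r_n$ modulo $2^n-1$. If $r_n(t)<n$, then $r_n(t+1)\neq r_n(t)$. More precisely, $r_n(t+1)=r_n(t)+1$ or $r_n(t+1)=r_n(t)-1$. -/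

import Mathlib

open Polynomial

/-- `f` is a primitive polynomial of degree `n` over `𝔽₂`: it is the minimal polynomial over `𝔽₂`
of a primitive element of `𝔽_{2^n}`, i.e. of a generator of its (cyclic, order `2 ^ n - 1`)
multiplicative group. -/
def IsPrimitivePolynomial (n : ℕ) (f : (ZMod 2)[X]) : Prop :=
  ∃ α : GaloisField 2 n, orderOf α = 2 ^ n - 1 ∧ minpoly (ZMod 2) α = f

/-- `s` is generated by the `n`-stage linear feedback shift register whose characteristic
polynomial is `f = x ^ n + c_{n-1} x ^ (n-1) + ⋯ + c_0`, that is
`s_{t+n} = c_{n-1} s_{t+n-1} + ⋯ + c_0 s_t` for all `t`. -/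
def IsLFSRSequence (n : ℕ) (f : (ZMod 2)[X]) (s : ℕ → ZMod 2) : Prop :=
  f.Monic ∧ f.natDegree = n ∧
    ∀ t : ℕ, s (t + n) = ∑ i ∈ Finset.range n, f.coeff i * s (t + i)

/-- Binary m-sequences of order `n`: nonzero sequences generated by an `n`-stage linear feedback
shift register with primitive characteristic polynomial of degree `n`. -/
def IsMSequence (n : ℕ) (s : ℕ → ZMod 2) : Prop :=
  s ≠ 0 ∧ ∃ f : (ZMod 2)[X], IsPrimitivePolynomial n f ∧ IsLFSRSequence n f s

/-- The `n × t` observability matrix `G_t`, whose (zero-based) `(i, j)` entry is `s_{i+j}`. -/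
def observabilityMatrix (n : ℕ) (s : ℕ → ZMod 2) (t : ℕ) : Matrix (Fin n) (Fin t) (ZMod 2) :=
  Matrix.of fun i j => s (i + j)

/-- The rank over `𝔽₂` of the Gram matrix `G_t G_tᵀ`. -/
noncomputable def gramRank (n : ℕ) (s : ℕ → ZMod 2) (t : ℕ) : ℕ :=
  (observabilityMatrix n s t * (observabilityMatrix n s t).transpose).rank

/-- The representative in `{1, …, 2 ^ n - 1}` of a residue class modulo `2 ^ n - 1`
(for `n ≥ 1`). -/
def residueRep (n : ℕ) (t : ZMod (2 ^ n - 1)) : ℕ :=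
  if t = 0 then 2 ^ n - 1 else t.val

/-- The rank function `r_n(t) = rank (G_t G_tᵀ)`, `1 ≤ t ≤ 2 ^ n - 1`, with `t` regarded modulo
`2 ^ n - 1`. -/
noncomputable def cyclicGramRank (n : ℕ) (s : ℕ → ZMod 2) (t : ZMod (2 ^ n - 1)) : ℕ :=
  gramRank n s (residueRep n t)

/-! Passing from `t` to `t + 1` replaces the Gram matrix `M` by `M + v vᵀ`, where `v` is the window
of `s` at `t`. If `v` is outside the range of `M`, the rank rises by one. If `v = M x`, the rank
over 𝔽₂ drops by one when `v ⬝ᵥ x = 1` and is unchanged when `v ⬝ᵥ x = 0`, so the latter must be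
excluded for singular `M`.

Let polynomials act on `s` by shifts; then `M` is a bilinear form on the field 𝔽₂[X]/(f). Shifting
both arguments changes the form only by boundary terms at `0` and `t`, and `v ⬝ᵥ x = 0` forces the
radical to be stable under `X` (`X_mul_mem_windowRadical`), hence an ideal. Being nonzero it is
everything, so evaluation at `t` vanishes identically and periodicity gives `s = 0`, a contradiction
(`polyAct_ne_zero_of_represents`).

Cyclic indexing is consistent because the Gram matrix of a full period is zero
(`IsMSequence.gramRank_period`), like that of the empty window. -/

/-! ### Symmetric rank-one updates. -/

section RankOneUpdate

open Matrix

variable {m F : Type*} [Fintype m] [Field F]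

/-- Adding `v vᵀ` to a symmetric matrix increases the rank by one if `v` is not orthogonal to the
kernel. -/
theorem Matrix.IsSymm.rank_add_vecMulVec_of_dotProduct_ne_zero {M : Matrix m m F}
    (hM : M.IsSymm) {v y : m → F} (hy : M *ᵥ y = 0) (hvy : v ⬝ᵥ y ≠ 0) :
    (M + vecMulVec v v).rank = M.rank + 1 := by
  classical
  have hmul : ∀ w, (M + vecMulVec v v) *ᵥ w = M *ᵥ w + (v ⬝ᵥ w) • v := by
    intro w
    rw [add_mulVec, vecMulVec_mulVec]
    simp
  have hv : v ∉ LinearMap.range M.mulVecLin := by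
    rintro ⟨x, hx⟩
    apply hvy
    rw [mulVecLin_apply] at hx
    rw [← hx, dotProduct_comm, dotProduct_mulVec, ← mulVec_transpose, hM.eq, hy, zero_dotProduct]
  have hv' : v ∈ LinearMap.range (M + vecMulVec v v).mulVecLin := by
    refine ⟨(v ⬝ᵥ y)⁻¹ • y, ?_⟩
    rw [mulVecLin_apply, mulVec_smul, hmul, hy, zero_add, smul_smul, inv_mul_cancel₀ hvy, one_smul]
  have hrange : LinearMap.range (M + vecMulVec v v).mulVecLin =
      LinearMap.range M.mulVecLin ⊔ Submodule.span F {v} := by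
    apply le_antisymm
    · rintro _ ⟨w, rfl⟩
      rw [mulVecLin_apply, hmul]
      exact Submodule.add_mem_sup ⟨w, rfl⟩
        (Submodule.smul_mem _ _ (Submodule.mem_span_singleton_self v))
    · refine sup_le ?_ ((Submodule.span_singleton_le_iff_mem _ _).2 hv')
      rintro _ ⟨w, rfl⟩
      have h : M.mulVecLin w = (M + vecMulVec v v).mulVecLin w - (v ⬝ᵥ w) • v := by
        simp only [mulVecLin_apply, hmul, add_sub_cancel_right]
      rw [h]
      exact Submodule.sub_mem _ ⟨w, rfl⟩ (Submodule.smul_mem _ _ hv')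
  have hv0 : v ≠ 0 := fun h => hv (h ▸ Submodule.zero_mem _)
  have hinf : LinearMap.range M.mulVecLin ⊓ Submodule.span F {v} = ⊥ :=
    disjoint_iff.1 ((Submodule.disjoint_span_singleton' hv0).2 hv)
  have h := Submodule.finrank_sup_add_finrank_inf_eq (LinearMap.range M.mulVecLin)
    (Submodule.span F {v})
  rw [hinf, finrank_bot, finrank_span_singleton hv0, ← hrange] at h
  exact h

/-- A vector orthogonal to the kernel of a symmetric matrix lies in its range. -/
theorem Matrix.IsSymm.exists_mulVec_eq_of_forall_dotProduct_eq_zero {M : Matrix m m F}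
    (hM : M.IsSymm) {v : m → F} (h : ∀ y, M *ᵥ y = 0 → v ⬝ᵥ y = 0) : ∃ x, M *ᵥ x = v := by
  classical
  -- Duality: a functional vanishing on the common kernel of the rows is a combination of the rows.
  have hspan : dotProductBilin F F v ∈
      Submodule.span F (Set.range fun i => dotProductBilin F F (M i)) := by
    apply mem_span_of_iInf_ker_le_ker
    intro y hy
    rw [Submodule.mem_iInf] at hy
    refine h y (funext fun i => ?_)
    exact hy i
  obtain ⟨c, hc⟩ := (Submodule.mem_span_range_iff_exists_fun F).1 hspan
  refine ⟨c, funext fun j => ?_⟩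
  have hj := LinearMap.congr_fun hc (Pi.single j 1)
  simp only [LinearMap.sum_apply, LinearMap.smul_apply, dotProductBilin_apply_apply,
    dotProduct_single, mul_one, smul_eq_mul] at hj
  rw [← hj, mulVec, dotProduct]
  exact Finset.sum_congr rfl fun i _ => by rw [mul_comm, hM.apply]

end RankOneUpdate

/-! ### Polynomials acting on sequences by shifts. -/

section PolynomialAction

variable {R : Type*} [CommRing R]

/-- The left shift of sequences. -/
def sequenceShift (R : Type*) [CommRing R] : Module.End R (ℕ → R) where
  toFun s j := s (j + 1)
  map_add' _ _ := rfl
  map_smul' _ _ := rfl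

/-- The polynomial `p` in the shift, applied to the sequence `s`. -/
noncomputable def polyAct (s : ℕ → R) : R[X] →ₗ[R] (ℕ → R) :=
  (LinearMap.applyₗ s).comp (aeval (sequenceShift R)).toLinearMap

theorem polyAct_apply (s : ℕ → R) (p : R[X]) : polyAct s p = aeval (sequenceShift R) p s := rfl

theorem polyAct_mul (s : ℕ → R) (p q : R[X]) :
    polyAct s (p * q) = aeval (sequenceShift R) p (polyAct s q) := by
  simp [polyAct_apply]

theorem polyAct_X_mul (s : ℕ → R) (p : R[X]) (j : ℕ) :
    polyAct s (X * p) j = polyAct s p (j + 1) := by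
  rw [polyAct_mul, aeval_X]
  rfl

theorem polyAct_one (s : ℕ → R) : polyAct s 1 = s := by
  simp [polyAct_apply]

theorem polyAct_X_pow (s : ℕ → R) (i j : ℕ) : polyAct s (X ^ i) j = s (i + j) := by
  induction i generalizing j with
  | zero => simp [polyAct_one]
  | succ i ih => rw [pow_succ', polyAct_X_mul, ih, add_assoc, add_comm j 1]

theorem polyAct_X_pow_mul (s : ℕ → R) (p : R[X]) (i j : ℕ) :
    polyAct s (X ^ i * p) j = polyAct s p (i + j) := by
  induction i generalizing j with
  | zero => simp
  | succ i ih => rw [pow_succ', mul_assoc, polyAct_X_mul, ih, add_assoc, add_comm j 1]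

theorem polyAct_eq_sum (s : ℕ → R) {p : R[X]} {n : ℕ} (hp : p.natDegree < n) (j : ℕ) :
    polyAct s p j = ∑ i ∈ Finset.range n, p.coeff i * s (i + j) := by
  conv_lhs => rw [p.as_sum_range' n hp, map_sum, Finset.sum_apply]
  refine Finset.sum_congr rfl fun i _ => ?_
  rw [← C_mul_X_pow_eq_monomial, ← smul_eq_C_mul, map_smul, Pi.smul_apply, polyAct_X_pow,
    smul_eq_mul]

theorem polyAct_eq_zero_of_dvd {s : ℕ → R} {f p : R[X]} (hf : polyAct s f = 0) (h : f ∣ p) :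
    polyAct s p = 0 := by
  obtain ⟨q, rfl⟩ := h
  rw [mul_comm, polyAct_mul, hf, map_zero]

/-- A sequence annihilated by a monic polynomial of degree `n` is determined by its first `n`
terms. -/
theorem eq_zero_of_polyAct_eq_zero {s : ℕ → R} {f : R[X]} (hm : f.Monic) (hf : polyAct s f = 0)
    (h : ∀ i < f.natDegree, s i = 0) : s = 0 := by
  funext j
  induction j using Nat.strong_induction_on with
  | _ j ih =>
    by_cases hj : j < f.natDegree
    · exact h j hj
    · have h0 := congrFun hf (j - f.natDegree)
      rw [polyAct_eq_sum s (Nat.lt_succ_self _), Finset.sum_range_succ, hm.coeff_natDegree,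
        one_mul, Finset.sum_eq_zero, zero_add, Nat.add_sub_cancel' (not_lt.1 hj)] at h0
      · exact h0
      · intro i hi
        have hi' := Finset.mem_range.1 hi
        rw [ih _ (by omega), Pi.zero_apply, mul_zero]

theorem IsMSequence.exists_irreducible {n : ℕ} (hn : 1 ≤ n) {s : ℕ → ZMod 2}
    (hs : IsMSequence n s) : ∃ f : (ZMod 2)[X], Irreducible f ∧ f.Monic ∧ f.natDegree = n ∧
      polyAct s f = 0 ∧ ∀ j k, f ∣ X ^ j - X ^ k ↔ j ≡ k [MOD 2 ^ n - 1] := by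
  obtain ⟨-, f, ⟨α, hα, rfl⟩, hm, hd, hrec⟩ := hs
  have hint : IsIntegral (ZMod 2) α := Algebra.IsIntegral.isIntegral α
  refine ⟨_, minpoly.irreducible hint, hm, hd, ?_, fun j k => ?_⟩
  · funext j
    rw [polyAct_eq_sum s (Nat.lt_succ_self _), Finset.sum_range_succ, hm.coeff_natDegree, hd,
      one_mul, add_comm n j, hrec]
    simp only [add_comm _ j]
    exact CharTwo.add_self_eq_zero _
  · have hα0 : α ≠ 0 := by
      rintro rfl
      rw [orderOf_zero] at hα
      have := Nat.pow_le_pow_right (n := 2) (by norm_num) hn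
      omega
    rw [← hα, minpoly.dvd_iff, map_sub, map_pow, map_pow, aeval_X, sub_eq_zero]
    have := pow_eq_pow_iff_modEq (x := Units.mk0 α hα0) (n := j) (m := k)
    rw [← orderOf_units, Units.val_mk0, Units.ext_iff] at this
    simpa using this

end PolynomialAction

/-! ### Shift-stability of the radical of the window form. -/

section RadicalStability

variable {F : Type*} [Field F]

/-- The polynomials `q` such that `q • s` is orthogonal, on the first `t` terms, to every
sequence `p • s`. -/
def windowRadical (s : ℕ → F) (t : ℕ) : Submodule F F[X] where
  carrier := {q | ∀ p, ∑ j ∈ Finset.range t, polyAct s p j * polyAct s q j = 0}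
  zero_mem' p := by simp
  add_mem' {q r} hq hr p := by
    simp only [map_add, Pi.add_apply, mul_add, Finset.sum_add_distrib]
    rw [hq p, hr p, add_zero]
  smul_mem' c q hq p := by
    simp only [map_smul, Pi.smul_apply, smul_eq_mul, mul_left_comm _ c, ← Finset.mul_sum]
    rw [hq p, mul_zero]

/-- Both sides are the sum over the indices `0, …, t`, split off at one end or the other. -/
theorem sum_polyAct_X_mul (s : ℕ → F) (t : ℕ) (p q : F[X]) :
    (∑ j ∈ Finset.range t, polyAct s (X * p) j * polyAct s (X * q) j) +
      polyAct s p 0 * polyAct s q 0 =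
    (∑ j ∈ Finset.range t, polyAct s p j * polyAct s q j) + polyAct s p t * polyAct s q t := by
  simp only [polyAct_X_mul]
  rw [← Finset.sum_range_succ (fun j => polyAct s p j * polyAct s q j),
    Finset.sum_range_succ' (fun j => polyAct s p j * polyAct s q j)]

theorem Submodule.mul_mem_of_X_mul_mem {K : Submodule F F[X]} (hK : ∀ q ∈ K, X * q ∈ K)
    (p : F[X]) {q : F[X]} (hq : q ∈ K) : p * q ∈ K := by
  have hpow : ∀ k, X ^ k * q ∈ K := by
    intro k
    induction k with
    | zero => simpa using hq
    | succ k ih => rw [pow_succ', mul_assoc]; exact hK _ ih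
  induction p using Polynomial.induction_on' with
  | add a b ha hb => rw [add_mul]; exact K.add_mem ha hb
  | monomial k c =>
    rw [← C_mul_X_pow_eq_monomial, mul_assoc, ← smul_eq_C_mul]
    exact K.smul_mem _ (hpow k)

theorem polyAct_X_pow_mul_of_dvd {s : ℕ → F} {f : F[X]} (hf : polyAct s f = 0) {N : ℕ}
    (hN : f ∣ X ^ N - 1) (p : F[X]) : polyAct s (X ^ N * p) = polyAct s p := by
  rw [← sub_eq_zero, ← map_sub, ← sub_one_mul]
  exact polyAct_eq_zero_of_dvd hf (hN.mul_right p)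

/-- If evaluation at `t` is represented by some `x` with `x t = 0`, then the radical is stable under
multiplication by `X`. -/
theorem X_mul_mem_windowRadical {s : ℕ → F} {f : F[X]} (hf : polyAct s f = 0) {N : ℕ}
    (hN0 : N ≠ 0) (hN : f ∣ X ^ N - 1) {t : ℕ} {x : F[X]}
    (hx : ∀ p, ∑ j ∈ Finset.range t, polyAct s p j * polyAct s x j = polyAct s p t)
    (hxt : polyAct s x t = 0) {q : F[X]} (hq : q ∈ windowRadical s t) :
    X * q ∈ windowRadical s t := by
  have hNX : ∀ p : F[X], X ^ N * p = X * (X ^ (N - 1) * p) := fun p => by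
    rw [← mul_assoc, mul_pow_sub_one hN0]
  have hend : ∀ y ∈ windowRadical s t, polyAct s y t = 0 := by
    intro y hy
    rw [← hx y, ← hy x]
    exact Finset.sum_congr rfl fun j _ => mul_comm _ _
  -- Radical elements vanish at `t`. If they also vanish at `0`, no boundary term survives, and `X ^
  -- (N - 1)` serves as the inverse of `X`.
  by_cases h0 : ∀ y ∈ windowRadical s t, polyAct s y 0 = 0
  · intro p
    have h := sum_polyAct_X_mul s t (X ^ (N - 1) * p) q
    rw [hend q hq, h0 q hq, hq, ← hNX, polyAct_X_pow_mul_of_dvd hf hN] at h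
    simpa using h
  · push Not at h0
    obtain ⟨z, hz, hz0⟩ := h0
    -- Correcting `x` by a multiple of `z` kills its value at `0` without affecting the other two
    -- properties.
    obtain ⟨w, hw, hwt, hw0⟩ : ∃ w : F[X],
        (∀ p, ∑ j ∈ Finset.range t, polyAct s p j * polyAct s w j = polyAct s p t) ∧
        polyAct s w t = 0 ∧ polyAct s w 0 = 0 := by
      refine ⟨x - (polyAct s x 0 / polyAct s z 0) • z, fun p => ?_, ?_, ?_⟩
      · have h := (windowRadical s t).smul_mem (polyAct s x 0 / polyAct s z 0) hz p
        simp only [map_sub, Pi.sub_apply, mul_sub, Finset.sum_sub_distrib, hx, h, sub_zero]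
      · simp [hxt, hend z hz]
      · simp [hz0]
    -- Stability under `X⁻¹` instead: pairing with `z` gives `y 0 = 0`, pairing with `w` gives `y t
    -- = 0`.
    have hdesc : ∀ y, X * y ∈ windowRadical s t → y ∈ windowRadical s t := by
      intro y hy
      have hswap : ∀ p, ∑ j ∈ Finset.range t, polyAct s (X * y) j * polyAct s p j = 0 := by
        intro p
        rw [← hy p]
        exact Finset.sum_congr rfl fun j _ => mul_comm _ _
      have hy0 : polyAct s y 0 = 0 := by
        have h := sum_polyAct_X_mul s t y z
        rw [hswap, hz, hend z hz] at h
        simpa [hz0] using h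
      have hyt : polyAct s y t = 0 := by
        have h := sum_polyAct_X_mul s t y w
        rw [hswap, hw, hwt, hw0] at h
        simpa using h.symm
      intro p
      have h := sum_polyAct_X_mul s t p y
      rw [hy, hy0, hyt] at h
      simpa using h.symm
    have hdescpow : ∀ k y, X ^ k * y ∈ windowRadical s t → y ∈ windowRadical s t := by
      intro k
      induction k with
      | zero => intro y hy; simpa using hy
      | succ k ih =>
        intro y hy
        rw [pow_succ', mul_assoc] at hy
        exact ih y (hdesc _ hy)
    -- On `s`, `X` acts as the `(N - 1)`-st power of `X⁻¹`.
    apply hdescpow (N - 1)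
    rw [mul_left_comm, ← hNX]
    intro p
    rw [polyAct_X_pow_mul_of_dvd hf hN]
    exact hq p

/-- By Bézout, a polynomial coprime to `f` that kills `s` would make `1` kill `s`. -/
theorem polyAct_eq_zero_iff_dvd {s : ℕ → F} (hs : s ≠ 0) {f : F[X]} (hirr : Irreducible f)
    (hf : polyAct s f = 0) {p : F[X]} : polyAct s p = 0 ↔ f ∣ p := by
  refine ⟨fun hp => ?_, polyAct_eq_zero_of_dvd hf⟩
  by_contra hfp
  obtain ⟨a, b, hab⟩ := (hirr.coprime_iff_not_dvd).2 hfp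
  apply hs
  rw [← polyAct_one s, ← hab, map_add, polyAct_mul, polyAct_mul, hf, hp]
  simp

/-- If the radical contains a `q` that does not annihilate `s`, a polynomial representing
evaluation at `t` does not vanish at `t`. -/
theorem polyAct_ne_zero_of_represents {s : ℕ → F} (hs : s ≠ 0) {f : F[X]} (hirr : Irreducible f)
    (hf : polyAct s f = 0) {N : ℕ} (hN0 : N ≠ 0) (hN : f ∣ X ^ N - 1) {t : ℕ} {q x : F[X]}
    (hfq : ¬ f ∣ q) (hq : q ∈ windowRadical s t)
    (hx : ∀ p, ∑ j ∈ Finset.range t, polyAct s p j * polyAct s x j = polyAct s p t) :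
    polyAct s x t ≠ 0 := by
  intro hxt
  have hmul := fun p {r} => Submodule.mul_mem_of_X_mul_mem (q := r)
    (fun r => X_mul_mem_windowRadical hf hN0 hN hx hxt) p
  have hfmem : f ∈ windowRadical s t := fun p => by simp [hf]
  obtain ⟨a, b, hab⟩ := (hirr.coprime_iff_not_dvd).2 hfq
  have hone : 1 ∈ windowRadical s t := by
    rw [← hab]
    exact Submodule.add_mem _ (hmul a hfmem) (hmul b hq)
  have hxmem : x ∈ windowRadical s t := by simpa using hmul x hone
  have htail : ∀ j, s (j + t) = 0 := by
    intro j
    rw [← polyAct_X_pow s j t, ← hx, hxmem]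
  have hper : ∀ k j, s (k * N + j) = s j := by
    intro k
    induction k with
    | zero => simp
    | succ k ih =>
      intro j
      have h := congrFun (polyAct_X_pow_mul_of_dvd hf hN (X ^ (k * N))) j
      rwa [← pow_add, polyAct_X_pow, polyAct_X_pow, ih, add_comm N, ← Nat.succ_mul] at h
  apply hs
  funext j
  -- The index is chosen so that adding `t` lands on `j` plus a whole number of periods.
  have h := htail (t * N - t + j)
  have hle : t ≤ t * N := Nat.le_mul_of_pos_right t (Nat.pos_of_ne_zero hN0)
  rw [show t * N - t + j + t = t * N + j by omega, hper] at h
  exact h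

end RadicalStability

/-! ### Gram ranks of m-sequences and the wrap-around. -/

section GramRank

open Matrix

variable {n : ℕ} {s : ℕ → ZMod 2}

theorem gram_succ (n : ℕ) (s : ℕ → ZMod 2) (t : ℕ) :
    observabilityMatrix n s (t + 1) * (observabilityMatrix n s (t + 1))ᵀ =
      observabilityMatrix n s t * (observabilityMatrix n s t)ᵀ +
        vecMulVec (fun i : Fin n => s (i + t)) (fun i : Fin n => s (i + t)) := by
  ext i k
  simp [observabilityMatrix, mul_apply, Fin.sum_univ_castSucc, vecMulVec_apply]

theorem polyAct_sum_C_mul_X_pow (s : ℕ → ZMod 2) (a : Fin n → ZMod 2) (j : ℕ) :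
    polyAct s (∑ i : Fin n, C (a i) * X ^ (i : ℕ)) j = (fun i : Fin n => s (i + j)) ⬝ᵥ a := by
  simp only [map_sum, Finset.sum_apply, ← smul_eq_C_mul, map_smul, Pi.smul_apply, polyAct_X_pow,
    smul_eq_mul, dotProduct]
  exact Finset.sum_congr rfl fun i _ => mul_comm _ _

theorem dotProduct_gram_mulVec (s : ℕ → ZMod 2) (t : ℕ) (a b : Fin n → ZMod 2) :
    a ⬝ᵥ (observabilityMatrix n s t * (observabilityMatrix n s t)ᵀ) *ᵥ b =
      ∑ j ∈ Finset.range t, polyAct s (∑ i : Fin n, C (a i) * X ^ (i : ℕ)) j *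
        polyAct s (∑ i : Fin n, C (b i) * X ^ (i : ℕ)) j := by
  rw [← mulVec_mulVec, dotProduct_mulVec, ← mulVec_transpose, Finset.sum_range]
  simp only [polyAct_sum_C_mul_X_pow]
  rfl

theorem exists_polyAct_sum_C_mul_X_pow_eq {f : (ZMod 2)[X]} (hm : f.Monic)
    (hd : f.natDegree = n) (hn : 1 ≤ n) (hf : polyAct s f = 0) (p : (ZMod 2)[X]) :
    ∃ a : Fin n → ZMod 2, polyAct s (∑ i : Fin n, C (a i) * X ^ (i : ℕ)) = polyAct s p := by
  refine ⟨fun i => (p %ₘ f).coeff i, ?_⟩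
  have hlt : (p %ₘ f).natDegree < n := by
    rw [← hd]
    exact natDegree_modByMonic_lt p hm (by rintro rfl; simp at hd; omega)
  have h1 : ∑ i : Fin n, C ((p %ₘ f).coeff i) * X ^ (i : ℕ) = p %ₘ f := by
    rw [Fin.sum_univ_eq_sum_range (fun i => C ((p %ₘ f).coeff i) * X ^ i)]
    exact ((p %ₘ f).as_sum_range_C_mul_X_pow' hlt).symm
  rw [h1]
  conv_rhs => rw [← modByMonic_add_div p f]
  rw [map_add, polyAct_eq_zero_of_dvd hf (dvd_mul_right _ _), add_zero]

/-- Below full rank, consecutive Gram ranks differ by exactly one. -/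
theorem IsMSequence.gramRank_succ (hn : 1 ≤ n) (hs : IsMSequence n s) {t : ℕ}
    (ht : gramRank n s t < n) :
    gramRank n s (t + 1) = gramRank n s t + 1 ∨ gramRank n s t = gramRank n s (t + 1) + 1 := by
  obtain ⟨f, hirr, hm, hd, hf, hX⟩ := hs.exists_irreducible hn
  set M := observabilityMatrix n s t * (observabilityMatrix n s t)ᵀ with hM
  set v : Fin n → ZMod 2 := fun i => s (i + t) with hv
  have hsymm : M.IsSymm := by
    rw [hM, IsSymm, transpose_mul, transpose_transpose]
  have hrank : gramRank n s t = M.rank := rfl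
  have hrank' : gramRank n s (t + 1) = (M + vecMulVec v v).rank := by
    rw [gramRank, gram_succ]
  rw [hrank] at ht
  rw [hrank, hrank']
  by_cases hker : ∀ y, M *ᵥ y = 0 → v ⬝ᵥ y = 0
  · right
    obtain ⟨x, hx⟩ := hsymm.exists_mulVec_eq_of_forall_dotProduct_eq_zero hker
    obtain ⟨y, hy, hy0⟩ : ∃ y, M *ᵥ y = 0 ∧ y ≠ 0 := by
      by_contra! h
      have hinj : Function.Injective M.mulVecLin :=
        (injective_iff_map_eq_zero M.mulVecLin).2 fun y hy => h y hy
      have := LinearMap.finrank_range_of_inj hinj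
      rw [Module.finrank_fin_fun] at this
      exact ht.ne this
    have hvx : v ⬝ᵥ x ≠ 0 := by
      rw [hv, ← polyAct_sum_C_mul_X_pow]
      have hN : 2 ^ n - 1 ≠ 0 := by
        have := Nat.pow_le_pow_right (n := 2) (by norm_num) hn
        omega
      refine polyAct_ne_zero_of_represents hs.1 hirr hf hN
        (q := ∑ i : Fin n, C (y i) * X ^ (i : ℕ)) ?_ ?_ ?_ ?_
      · simpa using (hX (2 ^ n - 1) 0).2 (by simp [Nat.ModEq])
      · intro hdvd
        apply hy0
        have hzero : ∑ i : Fin n, C (y i) * X ^ (i : ℕ) = 0 := by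
          refine eq_zero_of_dvd_of_degree_lt hdvd ?_
          rw [degree_eq_natDegree hm.ne_zero, hd]
          exact degree_sum_fin_lt y
        funext i
        have hc := congrArg (fun p => coeff p (i : ℕ)) hzero
        simpa [finsetSum_coeff, coeff_X_pow, Fin.val_inj] using hc
      · intro p
        obtain ⟨a, ha⟩ := exists_polyAct_sum_C_mul_X_pow_eq hm hd hn hf p
        rw [← ha, ← dotProduct_gram_mulVec, ← hM, hy, dotProduct_zero]
      · intro p
        obtain ⟨a, ha⟩ := exists_polyAct_sum_C_mul_X_pow_eq hm hd hn hf p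
        rw [← ha, ← dotProduct_gram_mulVec, ← hM, hx, polyAct_sum_C_mul_X_pow, dotProduct_comm]
    have hvx1 : v ⬝ᵥ x = 1 := by
      generalize v ⬝ᵥ x = c at hvx
      revert hvx
      revert c
      decide
    have hcancel : M + vecMulVec v v + vecMulVec v v = M := by
      rw [add_assoc]
      ext i j
      simp [CharTwo.add_self_eq_zero]
    have hsymm' : (M + vecMulVec v v).IsSymm :=
      hsymm.add (by rw [IsSymm, transpose_vecMulVec])
    -- The drop is a rise read backwards: `x` lies in the kernel of `M + v vᵀ`, and adding `v vᵀ`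
    -- again restores `M`.
    have h := hsymm'.rank_add_vecMulVec_of_dotProduct_ne_zero (y := x) (v := v) ?_ hvx
    · rw [← h, hcancel]
    · rw [add_mulVec, vecMulVec_mulVec, hx, hvx1]
      ext i
      simp [CharTwo.add_self_eq_zero]
  · left
    push Not at hker
    obtain ⟨y, hy, hvy⟩ := hker
    exact hsymm.rank_add_vecMulVec_of_dotProduct_ne_zero hy hvy

theorem gramRank_zero (n : ℕ) (s : ℕ → ZMod 2) : gramRank n s 0 = 0 := by
  have : observabilityMatrix n s 0 * (observabilityMatrix n s 0)ᵀ = 0 := by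
    ext i j
    simp [mul_apply]
  rw [gramRank, this, rank_zero]

/-- Over a full period the windows of an m-sequence run once through all nonzero vectors. -/
theorem IsMSequence.image_window (hn : 1 ≤ n) (hs : IsMSequence n s) :
    Set.InjOn (fun (j : ℕ) (i : Fin n) => s (i + j)) (Finset.range (2 ^ n - 1)) ∧
    (Finset.range (2 ^ n - 1)).image (fun (j : ℕ) (i : Fin n) => s (i + j)) =
      Finset.univ.erase 0 := by
  obtain ⟨f, hirr, hm, hd, hf, hX⟩ := hs.exists_irreducible hn
  have hzero : ∀ p : (ZMod 2)[X], (∀ i < n, polyAct s p i = 0) → f ∣ p := by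
    intro p hp
    rw [← polyAct_eq_zero_iff_dvd hs.1 hirr hf]
    refine eq_zero_of_polyAct_eq_zero hm (f := f) ?_ (hd ▸ hp)
    rw [polyAct_apply, ← polyAct_mul, mul_comm, polyAct_mul, hf, map_zero]
  have hinj : Set.InjOn (fun (j : ℕ) (i : Fin n) => s (i + j)) (Finset.range (2 ^ n - 1)) := by
    intro j hj k hk hjk
    simp only [Finset.coe_range, Set.mem_Iio] at hj hk
    refine Nat.ModEq.eq_of_lt_of_lt ((hX j k).1 (hzero _ fun i hi => ?_)) hj hk
    have h := congrFun hjk ⟨i, hi⟩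
    simp only at h
    rw [map_sub, Pi.sub_apply, polyAct_X_pow, polyAct_X_pow, add_comm j, add_comm k, h, sub_self]
  refine ⟨hinj, Finset.eq_of_subset_of_card_le ?_ ?_⟩
  · intro v hv
    obtain ⟨j, -, rfl⟩ := Finset.mem_image.1 hv
    refine Finset.mem_erase.2 ⟨fun h0 => ?_, Finset.mem_univ _⟩
    -- A zero window would make `f` divide a power of `X`, yet `X` is a unit modulo `f`.
    have hdvd : f ∣ X ^ j := hzero _ fun i hi => by
      rw [polyAct_X_pow, add_comm]
      exact congrFun h0 ⟨i, hi⟩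
    have hone : f ∣ 1 := by
      have h1 : f ∣ X ^ ((2 ^ n - 1) * j) - X ^ 0 := (hX _ _).2 (by simp [Nat.ModEq])
      have h2 : f ∣ X ^ ((2 ^ n - 1) * j) := by
        rw [mul_comm, pow_mul]
        refine dvd_pow hdvd ?_
        have := Nat.pow_le_pow_right (n := 2) (by norm_num) hn
        omega
      simpa using (dvd_sub_right h2).1 h1
    exact hirr.not_isUnit (isUnit_of_dvd_one hone)
  · rw [Finset.card_image_of_injOn hinj]
    simp

/-- With `3 ≤ n` there is a coordinate other than `i` and `k`; flipping it pairs off equal terms. -/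
theorem sum_apply_mul_apply_eq_zero (hn : 3 ≤ n) (i k : Fin n) :
    ∑ u : Fin n → ZMod 2, u i * u k = 0 := by
  obtain ⟨l, hl⟩ : ∃ l : Fin n, l ∉ ({i, k} : Finset (Fin n)) := by
    by_contra! h
    have h1 := Finset.card_le_card (fun l _ => h l : Finset.univ ⊆ ({i, k} : Finset (Fin n)))
    have h2 := Finset.card_le_two (a := i) (b := k)
    rw [Finset.card_univ, Fintype.card_fin] at h1
    omega
  simp only [Finset.mem_insert, Finset.mem_singleton, not_or] at hl
  refine Finset.sum_involution (fun u _ => u + Pi.single l 1) ?_ ?_ ?_ ?_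
  · intro u _
    simp [Pi.single_eq_of_ne (Ne.symm hl.1), Pi.single_eq_of_ne (Ne.symm hl.2),
      CharTwo.add_self_eq_zero]
  · intro u _ _ h
    have := congrFun h l
    simp at this
  · simp
  · intro u _
    ext j
    rw [Pi.add_apply, Pi.add_apply, add_assoc, CharTwo.add_self_eq_zero, add_zero]

theorem IsMSequence.gramRank_period (hn : 3 ≤ n) (hs : IsMSequence n s) :
    gramRank n s (2 ^ n - 1) = 0 := by
  obtain ⟨hinj, himage⟩ := hs.image_window (by omega)
  have : observabilityMatrix n s (2 ^ n - 1) * (observabilityMatrix n s (2 ^ n - 1))ᵀ = 0 := by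
    ext i k
    simp only [mul_apply, observabilityMatrix, transpose_apply, of_apply, Matrix.zero_apply]
    rw [← Finset.sum_range (fun j => s (i + j) * s (k + j)),
      ← Finset.sum_image (f := fun u : Fin n → ZMod 2 => u i * u k) hinj, himage,
      Finset.sum_erase _ (by simp), sum_apply_mul_apply_eq_zero hn]
  rw [gramRank, this, rank_zero]

theorem IsMSequence.cyclicGramRank_eq (hn : 3 ≤ n) (hs : IsMSequence n s)
    (t : ZMod (2 ^ n - 1)) : cyclicGramRank n s t = gramRank n s t.val := by
  unfold cyclicGramRank residueRep
  split_ifs with h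
  · rw [hs.gramRank_period hn, h, ZMod.val_zero, gramRank_zero]
  · rfl

theorem IsMSequence.cyclicGramRank_add_one (hn : 3 ≤ n) (hs : IsMSequence n s)
    (t : ZMod (2 ^ n - 1)) : cyclicGramRank n s (t + 1) = gramRank n s (t.val + 1) := by
  have h8 := Nat.pow_le_pow_right (n := 2) (by norm_num) hn
  have : NeZero (2 ^ n - 1) := ⟨by omega⟩
  have : Fact (1 < 2 ^ n - 1) := ⟨by omega⟩
  rw [hs.cyclicGramRank_eq hn, ZMod.val_add, ZMod.val_one]
  rcases (Nat.succ_le_of_lt t.val_lt).eq_or_lt with h | h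
  -- Wrap-around: residue `0` and the full period both have rank `0`.
  · rw [Nat.succ_eq_add_one] at h
    rw [h, Nat.mod_self, gramRank_zero, hs.gramRank_period hn]
  · rw [Nat.mod_eq_of_lt h]

end GramRank

theorem theorem3 (n : ℕ) (hn : 3 ≤ n) (s : ℕ → ZMod 2) (hs : IsMSequence n s)
    (t : ZMod (2 ^ n - 1)) (ht : cyclicGramRank n s t < n) :
    cyclicGramRank n s (t + 1) ≠ cyclicGramRank n s t ∧
      ((cyclicGramRank n s (t + 1) : ℤ) = (cyclicGramRank n s t : ℤ) + 1 ∨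
        (cyclicGramRank n s (t + 1) : ℤ) = (cyclicGramRank n s t : ℤ) - 1) := by
  rw [hs.cyclicGramRank_eq hn] at ht
  rw [hs.cyclicGramRank_add_one hn, hs.cyclicGramRank_eq hn]
  have := hs.gramRank_succ (by omega) ht
  omega
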